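/- Let $d$ be a prime power, i.e. $d=p^k$ with $p$ a prime number and $k\ge 1$. Let $\overline{\mathbb{Q}}$ be the field of algebraic numbers, and for $t\in\overline{\mathbb{Q}}$ put $f_t(z)=z^d+t$; write $f_t^m$ for the $m$-fold composition of $f_t$ with itself. Let $a,b\in\overline{\mathbb{Q}}$ be such that exactly one of $a$ and $b$ is an algebraic integer. Then the set $$S=\{t_0\in\overline{\mathbb{Q}}:\ f_{t_0}^m(a)=f_{t_0}^n(b)\ \text{for some positive integers } m,n\}$$ has bounded height; that is, there is a real number $B$ (which may depend on $d,a,b$) such that $h(t_0)\le B$ for all $t_0\in S$, where $h$ is the absolute logarithmic Weil height on $\overline{\mathbb{Q}}$. -/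

import Mathlib

/-- The field `ℚ̄` of algebraic numbers. -/
abbrev Qbar : Type := AlgebraicClosure ℚ

/-- The specialization `f_t(z) = z ^ d + t` at `t` of the family `f(z) = z ^ d + t`. -/
noncomputable def unicritical (d : ℕ) (t : Qbar) : Qbar → Qbar := fun z => z ^ d + t

/-- A set of algebraic numbers has bounded height if the absolute logarithmic Weil height
is bounded on it. The height is nonnegative, so only an upper bound is required. -/
def HasBoundedHeight (S : Set Qbar) : Prop :=
  ∃ B : ℝ, ∀ t ∈ S, NumberField.absLogHeight₁ t ≤ B

/-! Suppose first that `m ≠ n`. If `t` is large at a place compared with `a` and `b`, then the first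
iterates of `a` and `b` both have size about `|t|` and escape, so the orbit that has run longer is
strictly larger and no collision occurs. Thus `t` is bounded at every place, hence in height.

Suppose `m = n`, and take the first collision. It is not at time 1, since `a ^ d = b ^ d` would make
both points integral; let it be at time `j + 2`. At each finite place `p * t` is bounded in terms of
`a` and `b`: when `t` is large, the quotient of the `(j + 1)`-st iterates is a nontrivial root of
unity of `p`-power order, which stays at distance at least `|p|` from 1, and this transfers back to
the quotient `u = f(a) / f(b)`. At the infinite places only an average is controlled: each conjugate
of `t` is a root of a polynomial with leading coefficient `d`, whose Mahler measure gives a total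
`log⁺` of order `d ^ j`.

It remains to see that `t` has degree at least of order `d ^ j`. This comes from a place where the
nonintegral point has a pole (`NumberField.pow_le_finrank_of_iterate_eq`). There `|t| > 1` and `u`
is a unit. Above `p`, `|u - 1| < 1` and `|p| ≤ |u - 1| ^ d ^ j` force large ramification. Away from
`p`, the residue of `u` has order divisible by `d ^ j`, and lifting the exponent forces a large
residue degree. -/

/-- The polynomial map `z ↦ z ^ d + t` on a commutative ring. -/
def unicriticalMap {R : Type*} [CommRing R] (d : ℕ) (t : R) : R → R := fun z => z ^ d + t

theorem map_iterate_unicriticalMap {R S : Type*} [CommRing R] [CommRing S] (φ : R →+* S)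
    (d : ℕ) (t : R) (m : ℕ) (z : R) :
    φ ((unicriticalMap d t)^[m] z) = (unicriticalMap d (φ t))^[m] (φ z) := by
  induction m generalizing z with
  | zero => rfl
  | succ m ih => simp [Function.iterate_succ_apply, ih, unicriticalMap]

/-! ### Escaping points and their ratios at a nonarchimedean place. -/

section Valuation

variable {F Γ : Type*} [Field F] [LinearOrderedCommGroupWithZero Γ] (v : Valuation F Γ)

theorem Valuation.map_unicriticalMap_of_lt {d : ℕ} {t x : F} (h : v t < v x ^ d) :
    v (unicriticalMap d t x) = v x ^ d := by
  rw [unicriticalMap, v.map_add_eq_of_lt_left (by rwa [map_pow]), map_pow]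

/-- The bound `|f y| ≤ max (|y| ^ d) |t| < |x| ^ d = |f x|` keeps the order strict, and the
hypotheses on `x` pass to `f x`. -/
theorem Valuation.map_iterate_lt_of_lt {d : ℕ} (hd : d ≠ 0) {t x y : F} (hx : 1 < v x)
    (ht : v t < v x ^ d) (hy : v y < v x) (j : ℕ) :
    v ((unicriticalMap d t)^[j] y) < v ((unicriticalMap d t)^[j] x) := by
  induction j generalizing x y with
  | zero => exact hy
  | succ j ih =>
    rw [Function.iterate_succ_apply, Function.iterate_succ_apply]
    have hfx := v.map_unicriticalMap_of_lt ht
    have h1 : 1 < v x ^ d := one_lt_pow₀ hx hd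
    refine ih (by rwa [hfx]) ?_ ?_
    · rw [hfx]
      exact ht.trans_le (le_self_pow₀ h1.le hd)
    · rw [hfx]
      refine (v.map_add _ _).trans_lt (max_lt ?_ ht)
      rw [map_pow]
      exact pow_lt_pow_left₀ hy zero_le hd

theorem Valuation.map_iterate_of_lt {d : ℕ} (hd : d ≠ 0) {t x : F} (hx : 1 < v x)
    (ht : v t < v x ^ d) (j : ℕ) :
    v ((unicriticalMap d t)^[j] x) = v x ^ d ^ j := by
  induction j generalizing x with
  | zero => simp
  | succ j ih =>
    have hfx := v.map_unicriticalMap_of_lt ht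
    have h1 : 1 < v x ^ d := one_lt_pow₀ hx hd
    rw [Function.iterate_succ_apply, ih (by rwa [hfx]), hfx, ← pow_mul, pow_succ']
    rw [hfx]
    exact ht.trans_le (le_self_pow₀ h1.le hd)

theorem Valuation.map_pow_sub_pow_le {x y : F} (hx : v x ≤ 1) (hy : v y ≤ 1) (n : ℕ) :
    v (x ^ n - y ^ n) ≤ v (x - y) := by
  obtain ⟨c, hc⟩ := sub_dvd_pow_sub_pow (⟨x, hx⟩ : v.integer) ⟨y, hy⟩ n
  have h : x ^ n - y ^ n = (x - y) * c := congrArg Subtype.val hc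
  rw [h, map_mul]
  exact mul_le_of_le_one_right' c.2

theorem Valuation.map_natCast_le_one (n : ℕ) : v (n : F) ≤ 1 :=
  natCast_mem v.integer n

theorem Valuation.exists_pow_prime_sub_one_eq {p : ℕ} (hp : p.Prime) {x : F} (hx : v x ≤ 1) :
    ∃ r : F, v r ≤ 1 ∧ x ^ p - 1 = (x - 1) ^ p + p * (x - 1) * r := by
  have hx1 : v (x - 1) ≤ 1 := (v.map_sub _ _).trans (max_le hx (by simp))
  obtain ⟨r, hr⟩ := exists_add_pow_prime_eq hp (⟨x - 1, hx1⟩ : v.integer) 1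
  refine ⟨r, r.2, ?_⟩
  have h : (x - 1 + 1) ^ p = (x - 1) ^ p + 1 ^ p + p * (x - 1) * 1 * r := by
    simpa using congrArg Subtype.val hr
  rw [sub_add_cancel, one_pow, mul_one] at h
  rw [h]
  ring

/-- In `x ^ p - 1 = (x - 1) ^ p + p (x - 1) r` the last term has size below `|p|` when `p ≠ 0` and
`|x - 1| < 1`, so it cannot account for a left side of size at least `|p|`. -/
theorem Valuation.map_pow_prime_sub_one_le {p : ℕ} (hp : p.Prime) {x : F} (hx : v x ≤ 1)
    (h : v (p : F) ≤ v (x ^ p - 1)) : v (x ^ p - 1) ≤ v (x - 1) ^ p := by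
  obtain ⟨r, hr, hxr⟩ := v.exists_pow_prime_sub_one_eq hp hx
  have hx1 : v (x - 1) ≤ 1 := (v.map_sub _ _).trans (max_le hx (by simp))
  have hmax : v (x ^ p - 1) ≤ max (v (x - 1) ^ p) (v (p : F) * v (x - 1)) := by
    rw [hxr]
    refine (v.map_add _ _).trans (max_le_max (by rw [map_pow]) ?_)
    rw [map_mul, map_mul]
    exact mul_le_of_le_one_right' hr
  by_contra! hlt
  have h2 : v (x ^ p - 1) ≤ v (p : F) * v (x - 1) :=
    (le_max_iff.mp hmax).resolve_left hlt.not_ge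
  rcases hx1.lt_or_eq with h3 | h3
  · rcases eq_or_ne (v (p : F)) 0 with h0 | h0
    · rw [h0, zero_mul] at h2
      exact (hlt.trans_le h2).not_ge zero_le
    · have : v (p : F) * v (x - 1) < v (p : F) :=
        mul_lt_of_lt_one_right (zero_lt_iff.mpr h0) h3
      exact (h.trans h2).not_gt this
  · rw [h3, one_pow] at hlt
    rw [h3, mul_one] at h2
    exact (hlt.trans_le h2).not_ge (v.map_natCast_le_one p)

theorem Valuation.map_pow_prime_pow_sub_one_le {p : ℕ} (hp : p.Prime) (k : ℕ) {x : F}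
    (hx : v x ≤ 1) (h : v (p : F) ≤ v (x ^ p ^ k - 1)) :
    v (x ^ p ^ k - 1) ≤ v (x - 1) ^ p ^ k := by
  induction k generalizing x with
  | zero => simp
  | succ k ih =>
    have hx1 : v (x - 1) ≤ 1 := (v.map_sub _ _).trans (max_le hx (by simp))
    have hxp : v (x ^ p) ≤ 1 := by rw [map_pow]; exact pow_le_one₀ zero_le hx
    have hxp1 : v (x ^ p - 1) ≤ 1 := (v.map_sub _ _).trans (max_le hxp (by simp))
    rw [pow_succ', pow_mul] at h ⊢
    have h1 := ih hxp h
    have h2 : v (p : F) ≤ v (x ^ p - 1) :=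
      (h.trans h1).trans (pow_le_of_le_one zero_le hxp1 (pow_ne_zero _ hp.ne_zero))
    refine h1.trans ?_
    rw [pow_mul]
    exact pow_le_pow_left₀ zero_le (v.map_pow_prime_sub_one_le hp hx h2) _

/-- A nontrivial root of unity of `p`-power order is at distance at least `|p|` from `1`. -/
theorem Valuation.map_prime_le_map_sub_one {p : ℕ} (hp : p.Prime) {k : ℕ} {ζ : F}
    (hζ : ζ ^ p ^ k = 1) (h1 : ζ ≠ 1) : v (p : F) ≤ v (ζ - 1) := by
  induction k generalizing ζ with
  | zero => simp_all
  | succ k ih =>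
    have hv : v ζ = 1 := by
      have : v ζ ^ p ^ (k + 1) = 1 := by rw [← map_pow, hζ, map_one]
      exact (pow_eq_one_iff_of_nonneg zero_le (pow_ne_zero _ hp.ne_zero)).mp this
    by_cases hp1 : ζ ^ p = 1
    · have hsum : (p : F) = ∑ i ∈ Finset.range p, (1 - ζ ^ i) := by
        rw [Finset.sum_sub_distrib]
        have : ∑ i ∈ Finset.range p, ζ ^ i = 0 := by
          rw [geom_sum_eq h1, hp1, sub_self, zero_div]
        simp [this]
      rw [hsum]
      refine v.map_sum_le fun i _ => ?_
      rw [v.map_sub_swap]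
      simpa using v.map_pow_sub_pow_le hv.le (by simp : v (1 : F) ≤ 1) i
    · refine (ih (by rwa [← pow_mul, ← pow_succ']) hp1).trans ?_
      simpa using v.map_pow_sub_pow_le hv.le (by simp : v (1 : F) ≤ 1) p

/-- Frobenius is injective on a residue ring of characteristic `p`. -/
theorem Valuation.map_sub_one_lt_one_of_pow {p : ℕ} (hp : p.Prime) (hvp : v (p : F) < 1) {k : ℕ}
    {x : F} (hx : v x ≤ 1) (h : v (x ^ p ^ k - 1) < 1) : v (x - 1) < 1 := by
  induction k generalizing x with
  | zero => simpa using h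
  | succ k ih =>
    have hxp : v (x ^ p) ≤ 1 := by rw [map_pow]; exact pow_le_one₀ zero_le hx
    rw [pow_succ', pow_mul] at h
    have h2 := ih hxp h
    obtain ⟨r, hr, hxr⟩ := v.exists_pow_prime_sub_one_eq hp hx
    have hx1 : v (x - 1) ≤ 1 := (v.map_sub _ _).trans (max_le hx (by simp))
    have h3 : v (x - 1) ^ p < 1 := by
      rw [← map_pow, ← add_sub_cancel_right ((x - 1) ^ p) (p * (x - 1) * r), ← hxr]
      refine (v.map_sub _ _).trans_lt (max_lt h2 ?_)
      rw [map_mul, map_mul]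
      exact (mul_le_of_le_one_right' hr).trans_lt ((mul_le_of_le_one_right' hx1).trans_lt hvp)
    exact lt_of_not_ge fun h4 => h3.not_ge (one_le_pow₀ h4)

/-- One step of the iteration of `z ↦ z ^ d + t` on a ratio of escaping points. -/
theorem Valuation.map_div_unicriticalMap {d : ℕ} (hd : d ≠ 0) {t x y : F} (hxy : v x = v y)
    (hy : 1 < v y) (ht : v t < v y ^ d) :
    v (unicriticalMap d t x / unicriticalMap d t y - 1) = v ((x / y) ^ d - 1) ∧
      v (unicriticalMap d t x / unicriticalMap d t y - (x / y) ^ d) < 1 := by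
  have hfy := v.map_unicriticalMap_of_lt ht
  have hy0 : y ≠ 0 := by rintro rfl; simp at hy
  have h1 : 1 < v y ^ d := one_lt_pow₀ hy hd
  have hfy0 : unicriticalMap d t y ≠ 0 := by
    intro h; rw [h, map_zero] at hfy; rw [← hfy] at h1; exact h1.not_ge zero_le
  have hfy0' : y ^ d + t ≠ 0 := hfy0
  constructor
  · have e1 : unicriticalMap d t x / unicriticalMap d t y - 1 =
        (x ^ d - y ^ d) / unicriticalMap d t y := by
      rw [div_sub_one hfy0]; simp [unicriticalMap]
    have e2 : (x / y) ^ d - 1 = (x ^ d - y ^ d) / y ^ d := by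
      rw [div_pow, div_sub_one (pow_ne_zero _ hy0)]
    rw [e1, e2, map_div₀, map_div₀, hfy, map_pow]
  · have e : unicriticalMap d t x / unicriticalMap d t y - (x / y) ^ d =
        t / unicriticalMap d t y * (1 - (x / y) ^ d) := by
      simp only [unicriticalMap, div_pow]
      field_simp
      ring
    have hq : v ((x / y) ^ d) = 1 := by
      rw [map_pow, map_div₀, hxy, div_self (v.ne_zero_iff.mpr hy0), one_pow]
    rw [e, map_mul, map_div₀, hfy]
    refine (mul_le_of_le_one_right' ((v.map_sub _ _).trans (max_le (by simp) hq.le))).trans_lt ?_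
    exact (div_lt_one₀ (zero_lt_one.trans h1)).mpr ht

/-- One step of the map replaces the distance `|q - 1|` of the ratio `q` by exactly `|q ^ d - 1|`.
If the final distance is at least `|p|`, so are the earlier ones, and then each step bounds the new
distance by the `d`-th power of the old. -/
theorem Valuation.map_div_iterate_sub_one_le {p k : ℕ} (hp : p.Prime)
    {t x y : F} (hxy : v x = v y) (hy : 1 < v y) (ht : v t < v y ^ p ^ k) (j : ℕ)
    (h : v (p : F) ≤
      v ((unicriticalMap (p ^ k) t)^[j] x / (unicriticalMap (p ^ k) t)^[j] y - 1)) :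
    v ((unicriticalMap (p ^ k) t)^[j] x / (unicriticalMap (p ^ k) t)^[j] y - 1) ≤
      v (x / y - 1) ^ (p ^ k) ^ j := by
  have hd : p ^ k ≠ 0 := pow_ne_zero _ hp.ne_zero
  induction j generalizing x y with
  | zero => simp
  | succ j ih =>
    have hy0 : y ≠ 0 := by rintro rfl; simp at hy
    have hq : v (x / y) = 1 := by rw [map_div₀, hxy, div_self (v.ne_zero_iff.mpr hy0)]
    have hfy := v.map_unicriticalMap_of_lt ht
    have hfx : v (unicriticalMap (p ^ k) t x) = v x ^ p ^ k :=
      v.map_unicriticalMap_of_lt (by rwa [hxy])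
    have h1 : 1 < v y ^ p ^ k := one_lt_pow₀ hy hd
    simp only [Function.iterate_succ_apply] at h ⊢
    have h2 := ih (by rw [hfx, hfy, hxy]) (by rwa [hfy])
      (by rw [hfy]; exact ht.trans_le (le_self_pow₀ h1.le hd)) h
    rw [(v.map_div_unicriticalMap hd hxy hy ht).1] at h2
    have hq1 : v ((x / y) ^ p ^ k - 1) ≤ 1 :=
      (v.map_sub _ _).trans (max_le (by rw [map_pow, hq, one_pow]) (by simp))
    have h3 := v.map_pow_prime_pow_sub_one_le hp k hq.le
      ((h.trans h2).trans (pow_le_of_le_one zero_le hq1 (pow_ne_zero _ hd)))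
    refine h2.trans ?_
    rw [pow_succ' (p ^ k) j, pow_mul]
    exact pow_le_pow_left₀ zero_le h3 _

/-- In the residue field, the map acts on ratios of escaping points as the `d`-th power. -/
theorem Valuation.map_div_iterate_sub_pow_lt_one {d : ℕ} (hd : d ≠ 0) {t x y : F}
    (hxy : v x = v y) (hy : 1 < v y) (ht : v t < v y ^ d) (j : ℕ) :
    v ((unicriticalMap d t)^[j] x / (unicriticalMap d t)^[j] y - (x / y) ^ d ^ j) < 1 := by
  induction j generalizing x y with
  | zero => simp
  | succ j ih =>
    have hy0 : y ≠ 0 := by rintro rfl; simp at hy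
    have hq : v ((x / y) ^ d) = 1 := by
      rw [map_pow, map_div₀, hxy, div_self (v.ne_zero_iff.mpr hy0), one_pow]
    have hfy := v.map_unicriticalMap_of_lt ht
    have hfx : v (unicriticalMap d t x) = v x ^ d := v.map_unicriticalMap_of_lt (by rwa [hxy])
    have h1 : 1 < v y ^ d := one_lt_pow₀ hy hd
    have hfq : v (unicriticalMap d t x / unicriticalMap d t y) = 1 := by
      rw [map_div₀, hfx, hfy, hxy, div_self (zero_lt_one.trans h1).ne']
    simp only [Function.iterate_succ_apply]
    have h2 := ih (x := unicriticalMap d t x) (y := unicriticalMap d t y) (by rw [hfx, hfy, hxy])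
      (by rwa [hfy]) (by rw [hfy]; exact ht.trans_le (le_self_pow₀ h1.le hd))
    have h3 := (v.map_pow_sub_pow_le hfq.le hq.le (d ^ j)).trans_lt
      (v.map_div_unicriticalMap hd hxy hy ht).2
    rw [pow_succ' d j, pow_mul]
    simpa using (v.map_add _ _).trans_lt (max_lt h2 h3)

/-- The local information carried by a collision `f ^ (j + 1) x = f ^ (j + 1) y` that is not a
collision one step earlier, for `d` a power of `p` and points `x`, `y` of the size of `t`. -/
theorem Valuation.collision_estimates {p k : ℕ} (hp : p.Prime) (hk : k ≠ 0) {t x y : F}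
    (ht : 1 < v t) (hx : v x = v t) (hy : v y = v t) {j : ℕ}
    (hne : (unicriticalMap (p ^ k) t)^[j] x ≠ (unicriticalMap (p ^ k) t)^[j] y)
    (heq : (unicriticalMap (p ^ k) t)^[j + 1] x = (unicriticalMap (p ^ k) t)^[j + 1] y) :
    v (p : F) ≤ v (x / y - 1) ^ (p ^ k) ^ j ∧
      v ((x / y) ^ (p ^ k) ^ (j + 1) - 1) < 1 ∧
      (v (p : F) = 1 → v ((x / y) ^ (p ^ k) ^ j - 1) = 1) := by
  have hd : p ^ k ≠ 0 := pow_ne_zero _ hp.ne_zero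
  have hd2 : 1 < p ^ k := one_lt_pow₀ hp.one_lt hk
  have hxy : v x = v y := hx.trans hy.symm
  have hy1 : 1 < v y := hy ▸ ht
  have hty : v t < v y ^ p ^ k := by rw [hy]; exact lt_self_pow₀ ht hd2
  have hY := v.map_iterate_of_lt hd hy1 hty j
  have hY0 : (unicriticalMap (p ^ k) t)^[j] y ≠ 0 := by
    intro h
    rw [h, map_zero] at hY
    exact (pow_pos (zero_lt_one.trans hy1) _).ne hY
  -- A first collision means equal `d`-th powers of distinct points, so their quotient is a
  -- nontrivial root of unity.
  have hζ : ((unicriticalMap (p ^ k) t)^[j] x / (unicriticalMap (p ^ k) t)^[j] y) ^ p ^ k = 1 := by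
    rw [Function.iterate_succ_apply', Function.iterate_succ_apply'] at heq
    rw [div_pow, div_eq_one_iff_eq (pow_ne_zero _ hY0)]
    exact add_right_cancel heq
  have hζ1 : (unicriticalMap (p ^ k) t)^[j] x / (unicriticalMap (p ^ k) t)^[j] y ≠ 1 := by
    rwa [Ne, div_eq_one_iff_eq hY0]
  have h1 := v.map_prime_le_map_sub_one hp hζ hζ1
  have h2 := v.map_div_iterate_sub_pow_lt_one hd hxy hy1 hty j
  have h3 := v.map_div_iterate_sub_pow_lt_one hd hxy hy1 hty (j + 1)
  have hq : v (x / y) = 1 := by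
    rw [map_div₀, hxy, div_self (zero_lt_one.trans hy1).ne']
  refine ⟨h1.trans (v.map_div_iterate_sub_one_le hp hxy hy1 hty j h1), ?_, fun hp1 => ?_⟩
  · rw [heq, div_self, v.map_sub_swap] at h3
    · exact h3
    · intro h
      have hY' := v.map_iterate_of_lt hd hy1 hty (j + 1)
      rw [h, map_zero] at hY'
      exact (pow_pos (zero_lt_one.trans hy1) _).ne hY'
  · refine le_antisymm ((v.map_sub _ _).trans (max_le (by rw [map_pow, hq, one_pow]) (by simp))) ?_
    by_contra! hlt
    refine h1.not_gt ?_
    rw [hp1]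
    simpa using (v.map_add _ _).trans_lt (max_lt h2 hlt)

end Valuation

/-! ### Consequences of a collision at a nonarchimedean place. -/

section Valuation

variable {F Γ : Type*} [Field F] [LinearOrderedCommGroupWithZero Γ] (v : Valuation F Γ)

theorem Valuation.map_unicriticalMap_eq {d : ℕ} {t a : F} (h : v a ^ d < v t) :
    v (unicriticalMap d t a) = v t :=
  v.map_add_eq_of_lt_right (by rwa [map_pow])

/-- Otherwise `f a` and `f b` both have size `|t| > 1`; the extra `n - m` steps raise the orbit of
`b` to size `|t| ^ d ^ (n - m)`, after which it dominates the orbit of `a` forever. -/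
theorem Valuation.map_le_of_iterate_eq_of_lt {d : ℕ} (hd : 1 < d) {t a b : F} {m n : ℕ}
    (hm : 0 < m) (hmn : m < n) (h : (unicriticalMap d t)^[m] a = (unicriticalMap d t)^[n] b) :
    v t ≤ max 1 (max (v a ^ d) (v b ^ d)) := by
  by_contra! hlt
  obtain ⟨ht, ha, hb⟩ : 1 < v t ∧ v a ^ d < v t ∧ v b ^ d < v t := by simpa using hlt
  obtain ⟨m, rfl⟩ := Nat.exists_eq_succ_of_ne_zero hm.ne'
  obtain ⟨i, rfl⟩ := Nat.exists_eq_add_of_lt hmn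
  rw [show m.succ + i + 1 = m + ((i + 1) + 1) by omega, Function.iterate_add_apply,
    Function.iterate_succ_apply, Function.iterate_succ_apply _ (i + 1)] at h
  have hfa := v.map_unicriticalMap_eq ha
  have hfb := v.map_unicriticalMap_eq hb
  have htd : v t < v t ^ d := lt_self_pow₀ ht hd
  have hx := v.map_iterate_of_lt (d := d) (by omega) (t := t) (by rwa [hfb]) (by rwa [hfb]) (i + 1)
  rw [hfb] at hx
  have h1 : v t < v t ^ d ^ (i + 1) := lt_self_pow₀ ht (one_lt_pow₀ hd (by omega))
  have h2 := v.map_iterate_lt_of_lt (d := d) (t := t) (y := unicriticalMap d t a) (by omega)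
    (by rw [hx]; exact ht.trans h1)
    (by rw [hx]; exact h1.trans_le (le_self_pow₀ (ht.trans h1).le (by omega : d ≠ 0)))
    (by rw [hx, hfa]; exact h1) m
  exact h2.ne (congrArg v h)

/-- For large `t`, `|p|` is at most the distance of `f a / f b` from 1, which is `|a ^ d - b ^ d| /
|t|`. -/
theorem Valuation.map_prime_mul_le_of_iterate_eq {p k : ℕ} (hp : p.Prime) (hk : k ≠ 0)
    {t a b : F} {j : ℕ}
    (hne : (unicriticalMap (p ^ k) t)^[j + 1] a ≠ (unicriticalMap (p ^ k) t)^[j + 1] b)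
    (heq : (unicriticalMap (p ^ k) t)^[j + 2] a = (unicriticalMap (p ^ k) t)^[j + 2] b) :
    v (p * t) ≤ max 1 (max (v a ^ p ^ k) (v b ^ p ^ k)) := by
  rw [map_mul]
  by_cases h : v t ≤ max 1 (max (v a ^ p ^ k) (v b ^ p ^ k))
  · exact (mul_le_of_le_one_left' (v.map_natCast_le_one p)).trans h
  obtain ⟨ht, ha, hb⟩ : 1 < v t ∧ v a ^ p ^ k < v t ∧ v b ^ p ^ k < v t := by simpa using h
  have hfa := v.map_unicriticalMap_eq ha
  have hfb := v.map_unicriticalMap_eq hb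
  have ht0 : 0 < v t := zero_lt_one.trans ht
  have h1 := (v.collision_estimates hp hk ht hfa hfb (j := j) hne heq).1
  have hq : v (unicriticalMap (p ^ k) t a / unicriticalMap (p ^ k) t b) = 1 := by
    rw [map_div₀, hfa, hfb, div_self ht0.ne']
  have h2 : v (p : F) ≤ v (unicriticalMap (p ^ k) t a / unicriticalMap (p ^ k) t b - 1) :=
    h1.trans (pow_le_of_le_one zero_le ((v.map_sub _ _).trans (max_le hq.le (by simp)))
      (pow_ne_zero _ (pow_ne_zero _ hp.ne_zero)))
  have hb0 : unicriticalMap (p ^ k) t b ≠ 0 := by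
    intro h0; rw [h0, map_zero] at hfb; exact ht0.ne hfb
  rw [div_sub_one hb0, map_div₀, hfb, le_div_iff₀ ht0] at h2
  refine (h2.trans ?_).trans (le_max_right _ _)
  simpa [unicriticalMap] using v.map_sub (a ^ p ^ k) (b ^ p ^ k)

/-- If `|t| < |a| ^ d`, the orbit of `a` dominates that of `b`. Otherwise `|f b| = |t|`, and `|f a|
< |t|` would let the orbit of `b` dominate. -/
theorem Valuation.le_of_iterate_eq_of_map_le_one {d : ℕ} (hd : 1 < d) {t a b : F} (ha : 1 < v a)
    (hb : v b ≤ 1) {m : ℕ} (heq : (unicriticalMap d t)^[m + 1] a = (unicriticalMap d t)^[m + 1] b) :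
    1 < v t ∧ v (unicriticalMap d t a) = v t ∧ v (unicriticalMap d t b) = v t := by
  have hle : v a ^ d ≤ v t := by
    by_contra! h
    exact (v.map_iterate_lt_of_lt hd.ne_bot ha h (hb.trans_lt ha) (m + 1)).ne' (congrArg v heq)
  have ht : 1 < v t := (one_lt_pow₀ ha hd.ne_bot).trans_le hle
  have hfb : v (unicriticalMap d t b) = v t :=
    v.map_unicriticalMap_eq ((pow_le_one₀ zero_le hb).trans_lt ht)
  refine ⟨ht, le_antisymm ?_ ?_, hfb⟩
  · exact (v.map_add _ _).trans (max_le (by rwa [map_pow]) le_rfl)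
  · by_contra! h
    rw [Function.iterate_succ_apply, Function.iterate_succ_apply] at heq
    refine (v.map_iterate_lt_of_lt (d := d) hd.ne_bot (by rwa [hfb]) ?_ (by rwa [hfb]) m).ne
      (congrArg v heq)
    rw [hfb]
    exact lt_self_pow₀ ht hd

end Valuation

/-! ### Lifting the exponent. -/

theorem pow_dvd_mul_of_pow_dvd_pow_sub_one {p : ℕ} (hp : p.Prime) {c : ℤ} (hc : (p : ℤ) ∣ c - 1)
    (hc4 : p = 2 → 4 ∣ c - 1) {i f : ℕ} (h : (p : ℤ) ^ i ∣ c ^ f - 1) :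
    (p : ℤ) ^ i ∣ (c - 1) * f := by
  have hpc : ¬ (p : ℤ) ∣ c := by
    intro h1
    have : (p : ℤ) ∣ 1 := by simpa using dvd_sub h1 hc
    exact hp.one_lt.ne' (by exact_mod_cast Int.eq_one_of_dvd_one (by positivity) this)
  rw [pow_dvd_iff_le_emultiplicity] at h ⊢
  rw [emultiplicity_mul (Nat.prime_iff_prime_int.mp hp)]
  rcases hp.eq_two_or_odd' with rfl | hodd
  · have := Int.two_pow_sub_pow' (y := 1) f (hc4 rfl) hpc
    rw [one_pow] at this
    simpa [this] using h
  · have := Int.emultiplicity_pow_sub_pow (y := 1) hp hodd hc hpc f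
    rw [one_pow] at this
    rwa [this, ← Int.natCast_emultiplicity] at h

theorem pow_le_of_pow_dvd_pow_sub_one {p : ℕ} (hp : p.Prime) {l : ℕ} (hl : 1 < l)
    (hpl : p.Coprime l) {i f : ℕ} (hf : 0 < f) (h : p ^ i ∣ l ^ f - 1) :
    p ^ i ≤ l ^ (2 * p) * f := by
  -- Fermat gives `l ^ (p - 1) ≡ 1` modulo `p`; the factor 2 secures the congruence modulo 4 needed
  -- when `p = 2`.
  set e := 2 * (p - 1) with he
  have hp1 := hp.one_lt
  have hnp : ¬ p ∣ l := (Nat.Prime.coprime_iff_not_dvd hp).mp hpl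
  have hle : 1 ≤ l ^ e := Nat.one_le_pow _ _ (by omega)
  have hc : (p : ℤ) ∣ (l : ℤ) ^ e - 1 := by
    have h1 := Int.ModEq.pow_card_sub_one_eq_one hp (n := l)
      (Nat.isCoprime_iff_coprime.mpr hpl.symm)
    have h2 := h1.pow 2
    rw [← pow_mul, one_pow, mul_comm] at h2
    exact h2.symm.dvd
  have hc4 : p = 2 → (4 : ℤ) ∣ (l : ℤ) ^ e - 1 := by
    rintro rfl
    have hodd : Odd (l : ℤ) := by
      rw [Int.odd_coe_nat, ← Nat.not_even_iff_odd, even_iff_two_dvd]; exact hnp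
    exact dvd_trans (by norm_num : (4 : ℤ) ∣ 8)
      (by simpa [he] using Int.eight_dvd_sq_sub_one_of_odd hodd)
  have hdvd : (p : ℤ) ^ i ∣ ((l : ℤ) ^ e) ^ f - 1 := by
    have h1 : (p : ℤ) ^ i ∣ (l : ℤ) ^ f - 1 := by
      have := Int.natCast_dvd_natCast.mpr h
      rwa [Nat.cast_sub (Nat.one_le_pow _ _ (by omega)), Nat.cast_pow, Nat.cast_pow,
        Nat.cast_one] at this
    refine h1.trans ?_
    rw [← pow_mul, mul_comm e f, pow_mul]
    simpa using sub_dvd_pow_sub_pow ((l : ℤ) ^ f) 1 e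
  have h3 := pow_dvd_mul_of_pow_dvd_pow_sub_one hp hc hc4 hdvd
  have hlt : 1 < l ^ e := one_lt_pow₀ hl (by omega)
  have h4 : p ^ i ∣ (l ^ e - 1) * f := by
    zify [hle]
    exact h3
  refine (Nat.le_of_dvd (Nat.mul_pos (by omega) hf) h4).trans (Nat.mul_le_mul_right _ ?_)
  exact (Nat.sub_le _ _).trans (Nat.pow_le_pow_right (by omega) (by omega))

/-! ### Degree bounds and denominators from finite places. -/

section NumberField

open NumberField IsDedekindDomain

variable {L : Type*} [Field L] [NumberField L] (w : HeightOneSpectrum (𝓞 L))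

theorem IsDedekindDomain.HeightOneSpectrum.valuation_natCast_lt_one_iff (n : ℕ) :
    w.valuation L (n : L) < 1 ↔ (n : 𝓞 L) ∈ w.asIdeal := by
  rw [← w.valuation_lt_one_iff_mem (K := L)]
  change _ ↔ w.valuation L (algebraMap (𝓞 L) L n) < 1
  rw [map_natCast (algebraMap (𝓞 L) L)]

/-- The `M`-th power of the prime ideal divides `(p)`; compare norms, using `2 ≤ N(w)` and `p ≤ 2 ^
p`. -/
theorem IsDedekindDomain.HeightOneSpectrum.le_mul_finrank_of_valuation_le {p : ℕ} (hp : 1 < p)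
    {x : L} (hx : w.valuation L x < 1) {M : ℕ} (h : w.valuation L (p : L) ≤ w.valuation L x ^ M) :
    M ≤ p * Module.finrank ℚ L := by
  have hx1 : w.valuation L x ≤ WithZero.exp (-1 : ℤ) := by
    rw [← WithZero.exp_zero] at hx
    rcases eq_or_ne (w.valuation L x) 0 with h0 | h0
    · rw [h0]; exact zero_le
    · rw [← WithZero.exp_log h0, WithZero.exp_lt_exp] at hx
      rw [← WithZero.exp_log h0, WithZero.exp_le_exp]
      omega
  have h1 : w.intValuation (p : 𝓞 L) ≤ WithZero.exp (-(M : ℤ)) := by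
    rw [← w.valuation_of_algebraMap (K := L)]
    change w.valuation L (algebraMap (𝓞 L) L p) ≤ _
    rw [map_natCast (algebraMap (𝓞 L) L)]
    refine (h.trans (pow_le_pow_left₀ zero_le hx1 M)).trans_eq ?_
    rw [← WithZero.exp_nsmul]
    simp
  rw [HeightOneSpectrum.intValuation_le_pow_iff_dvd] at h1
  have h2 := Ideal.absNorm_dvd_absNorm_of_le (Ideal.le_of_dvd h1)
  rw [map_pow, Ideal.absNorm_span_natCast, RingOfIntegers.rank] at h2
  have h3 : 2 ^ M ≤ 2 ^ (p * Module.finrank ℚ L) :=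
    calc 2 ^ M ≤ (Ideal.absNorm w.asIdeal) ^ M :=
          Nat.pow_le_pow_left (NumberField.HeightOneSpectrum.one_lt_absNorm w) M
      _ ≤ p ^ Module.finrank ℚ L := Nat.le_of_dvd (pow_pos (by omega) _) h2
      _ ≤ (2 ^ p) ^ Module.finrank ℚ L := Nat.pow_le_pow_left (Nat.lt_two_pow_self).le _
      _ = _ := (pow_mul _ _ _).symm
  exact (Nat.pow_le_pow_iff_right (by norm_num)).mp h3

theorem IsDedekindDomain.HeightOneSpectrum.exists_absNorm_eq_prime_pow {N : ℕ} (hN : N ≠ 0)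
    (h : w.valuation L (N : L) < 1) :
    ∃ l f : ℕ, l.Prime ∧ l ≤ N ∧ 0 < f ∧ f ≤ Module.finrank ℚ L ∧
      w.valuation L (l : L) < 1 ∧ Ideal.absNorm w.asIdeal = l ^ f := by
  have hmem : ((N : ℕ) : 𝓞 L) ∈ w.asIdeal := (w.valuation_natCast_lt_one_iff N).mp h
  obtain ⟨l, hl, hlN, hlw⟩ : ∃ l : ℕ, l.Prime ∧ l ∣ N ∧ (l : 𝓞 L) ∈ w.asIdeal := by
    rw [← Nat.prod_primeFactorsList hN, Nat.cast_list_prod, ← Multiset.prod_coe,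
      w.isPrime.multiset_prod_mem_iff_exists_mem] at hmem
    obtain ⟨x, hx, hxw⟩ := hmem
    obtain ⟨l, hl, rfl⟩ := List.mem_map.mp (Multiset.mem_coe.mp hx)
    exact ⟨l, Nat.prime_of_mem_primeFactorsList hl, Nat.dvd_of_mem_primeFactorsList hl, hxw⟩
  have h2 := Ideal.absNorm_dvd_absNorm_of_le
    ((Ideal.span_singleton_le_iff_mem _).mpr hlw)
  rw [Ideal.absNorm_span_natCast, RingOfIntegers.rank] at h2
  obtain ⟨f, hf, hf2⟩ := (Nat.dvd_prime_pow hl).mp h2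
  refine ⟨l, f, hl, Nat.le_of_dvd (by omega) hlN, Nat.pos_of_ne_zero ?_, hf,
    (w.valuation_natCast_lt_one_iff l).mpr hlw, hf2⟩
  rintro rfl
  exact (NumberField.HeightOneSpectrum.one_lt_absNorm w).ne' hf2

/-- The residue of `u` has order a power of `p` that does not divide `p ^ i`, hence is a multiple of
it, and this order divides that of the residue field's unit group. -/
theorem IsDedekindDomain.HeightOneSpectrum.pow_dvd_absNorm_sub_one {p : ℕ} (hp : p.Prime)
    {u : L} (hu : w.valuation L u ≤ 1) {i i' : ℕ} (h1 : w.valuation L (u ^ p ^ i - 1) = 1)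
    (h2 : w.valuation L (u ^ p ^ i' - 1) < 1) : p ^ i ∣ Ideal.absNorm w.asIdeal - 1 := by
  have hmax : w.asIdeal.IsMaximal := w.isMaximal
  let _ : Field (𝓞 L ⧸ w.asIdeal) := Ideal.Quotient.field _
  have hcard : Ideal.absNorm w.asIdeal = Nat.card (𝓞 L ⧸ w.asIdeal) := rfl
  have hfin : Finite (𝓞 L ⧸ w.asIdeal) := Ideal.finiteQuotientOfFreeOfNeBot _ w.ne_bot
  let _ : Fintype (𝓞 L ⧸ w.asIdeal) := Fintype.ofFinite _
  obtain ⟨r, hr⟩ := w.exists_valuation_sub_lt_of_integer (K := L) hu 1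
  have hr1 : w.valuation L (algebraMap (𝓞 L) L r) ≤ 1 := w.valuation_le_one r
  have hpow (M : ℕ) : w.valuation L (algebraMap (𝓞 L) L r ^ M - u ^ M) < 1 :=
    ((w.valuation L).map_pow_sub_pow_le hr1 hu M).trans_lt hr
  have hkey (M : ℕ) : Ideal.Quotient.mk w.asIdeal r ^ M = 1 ↔ w.valuation L (u ^ M - 1) < 1 := by
    rw [← map_pow, ← map_one (Ideal.Quotient.mk w.asIdeal), Ideal.Quotient.eq,
      ← w.valuation_lt_one_iff_mem (K := L)]
    change w.valuation L (algebraMap (𝓞 L) L (r ^ M - 1)) < 1 ↔ _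
    rw [map_sub (algebraMap (𝓞 L) L), map_pow (algebraMap (𝓞 L) L), map_one]
    have e1 : algebraMap (𝓞 L) L r ^ M - 1 =
      (algebraMap (𝓞 L) L r ^ M - u ^ M) + (u ^ M - 1) := by ring
    have e2 : u ^ M - 1 =
      (algebraMap (𝓞 L) L r ^ M - 1) - (algebraMap (𝓞 L) L r ^ M - u ^ M) := by ring
    constructor
    · intro h
      rw [e2]
      exact (Valuation.map_sub _ _ _).trans_lt (max_lt h (hpow M))
    · intro h
      rw [e1]
      exact (Valuation.map_add _ _ _).trans_lt (max_lt (hpow M) h)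
  have ho2 := orderOf_dvd_of_pow_eq_one ((hkey _).mpr h2)
  obtain ⟨s, -, hs⟩ := (Nat.dvd_prime_pow hp).mp ho2
  have his : i ≤ s := by
    by_contra! hsi
    refine h1.not_lt ((hkey _).mp (orderOf_dvd_iff_pow_eq_one.mp ?_))
    rw [hs]
    exact pow_dvd_pow p hsi.le
  refine (pow_dvd_pow p his).trans ?_
  rw [← hs, hcard, Nat.card_eq_fintype_card]
  refine orderOf_dvd_of_pow_eq_one (FiniteField.pow_card_sub_one_eq_one _ ?_)
  intro h0
  have := (hkey _).mpr h2
  rw [h0, zero_pow (pow_ne_zero _ hp.ne_zero)] at this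
  exact zero_ne_one this

/-- A collision at time exactly `j + 2` between a point that is not integral and an integral point
forces the field of definition to have degree of order at least `(p ^ k) ^ j`. -/
theorem NumberField.pow_le_finrank_of_iterate_eq {p k : ℕ} (hp : p.Prime) (hk : k ≠ 0)
    {t a b : L} {N : ℕ} (hN : N ≠ 0) (hNa : IsIntegral ℤ (N * a)) (ha : ¬ IsIntegral ℤ a)
    (hb : IsIntegral ℤ b) {j : ℕ}
    (hne : (unicriticalMap (p ^ k) t)^[j + 1] a ≠ (unicriticalMap (p ^ k) t)^[j + 1] b)
    (heq : (unicriticalMap (p ^ k) t)^[j + 2] a = (unicriticalMap (p ^ k) t)^[j + 2] b) :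
    (p ^ k) ^ j ≤ p * N ^ (2 * p) * Module.finrank ℚ L := by
  have hint {x : L} (hx : IsIntegral ℤ x) (w : HeightOneSpectrum (𝓞 L)) : w.valuation L x ≤ 1 :=
    w.valuation_le_one (K := L) ⟨x, hx⟩
  obtain ⟨w, hw⟩ : ∃ w : HeightOneSpectrum (𝓞 L), 1 < w.valuation L a := by
    by_contra! h
    obtain ⟨r, hr⟩ := HeightOneSpectrum.mem_integers_of_valuation_le_one L a h
    exact ha (hr ▸ r.isIntegral_coe)
  set v := w.valuation L with hv
  obtain ⟨ht, hfa, hfb⟩ := v.le_of_iterate_eq_of_map_le_one (one_lt_pow₀ hp.one_lt hk) hw (hint hb w) heq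
  obtain ⟨h1, h2, h3⟩ := v.collision_estimates hp hk ht hfa hfb (j := j) hne heq
  set u := unicriticalMap (p ^ k) t a / unicriticalMap (p ^ k) t b
  have hu : v u = 1 := by rw [map_div₀, hfa, hfb, div_self (zero_lt_one.trans ht).ne']
  have hNw : v (N : L) < 1 := by
    by_contra! h
    have h4 := hint hNa w
    rw [map_mul] at h4
    exact (hw.trans_le (le_mul_of_one_le_left' h)).not_ge h4
  -- Above `p` the bound comes from ramification, away from `p` from the residue degree.
  rcases (v.map_natCast_le_one p).lt_or_eq with hvp | hvp
  · rw [← pow_mul] at h2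
    refine (w.le_mul_finrank_of_valuation_le hp.one_lt
      (v.map_sub_one_lt_one_of_pow hp hvp hu.le h2) h1).trans (Nat.mul_le_mul_right _ ?_)
    exact Nat.le_mul_of_pos_right _ (by positivity)
  · have h4 := h3 hvp
    rw [← pow_mul] at h2 h4
    have h5 := w.pow_dvd_absNorm_sub_one hp hu.le h4 h2
    obtain ⟨l, f, hl, hlN, hf0, hf, hlw, hlf⟩ := w.exists_absNorm_eq_prime_pow hN hNw
    rw [hlf] at h5
    have hpl : p.Coprime l := (Nat.coprime_primes hp hl).mpr (by rintro rfl; exact hlw.ne hvp)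
    rw [← pow_mul]
    refine (pow_le_of_pow_dvd_pow_sub_one hp hl.one_lt hpl hf0 h5).trans ?_
    refine Nat.mul_le_mul ?_ hf
    exact (Nat.pow_le_pow_left hlN _).trans (Nat.le_mul_of_pos_left _ hp.pos)

theorem NumberField.isIntegral_natCast_mul_of_valuation_le {t a b : L} {N q d : ℕ}
    (hNa : IsIntegral ℤ (N * a)) (hNb : IsIntegral ℤ (N * b))
    (h : ∀ w : HeightOneSpectrum (𝓞 L), w.valuation L (q * t) ≤
      max 1 (max (w.valuation L a ^ d) (w.valuation L b ^ d))) :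
    IsIntegral ℤ (((N ^ d * q : ℕ) : L) * t) := by
  have hint {x : L} (hx : IsIntegral ℤ x) (w : HeightOneSpectrum (𝓞 L)) : w.valuation L x ≤ 1 :=
    w.valuation_le_one (K := L) ⟨x, hx⟩
  suffices h1 : ∀ w : HeightOneSpectrum (𝓞 L),
      w.valuation L (((N ^ d * q : ℕ) : L) * t) ≤ 1 by
    obtain ⟨r, hr⟩ := HeightOneSpectrum.mem_integers_of_valuation_le_one L _ h1
    exact hr ▸ r.isIntegral_coe
  intro w
  have hN := (w.valuation L).map_natCast_le_one N
  have hNd : w.valuation L (N : L) ^ d ≤ 1 := pow_le_one₀ zero_le hN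
  rw [Nat.cast_mul, Nat.cast_pow, mul_assoc, map_mul, map_pow]
  refine (mul_le_mul_right (h w) _).trans ?_
  rcases max_choice (1 : WithZero (Multiplicative ℤ))
    (max (w.valuation L a ^ d) (w.valuation L b ^ d)) with h1 | h1 <;> rw [h1]
  · rwa [mul_one]
  · rcases max_choice (w.valuation L a ^ d) (w.valuation L b ^ d) with h2 | h2 <;> rw [h2]
    · rw [← mul_pow, ← map_mul]
      exact pow_le_one₀ zero_le (hint hNa w)
    · rw [← mul_pow, ← map_mul]
      exact pow_le_one₀ zero_le (hint hNb w)

end NumberField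

/-! ### Heights from a denominator and the complex conjugates. -/

section Height

open NumberField Height Real

variable {K : Type*} [Field K] [NumberField K]

/-- Each factor `max |x| 1` times `|N|` is at most 1, and the product formula evaluates the product
of the `|N|`. -/
theorem NumberField.finprod_max_one_le_pow {x : K} {N : ℕ} (hN : N ≠ 0)
    (hx : IsIntegral ℤ ((N : K) * x)) :
    ∏ᶠ w : FinitePlace K, max (w x) 1 ≤ (N : ℝ) ^ Module.finrank ℚ K := by
  have hN0 : (N : K) ≠ 0 := Nat.cast_ne_zero.mpr hN
  have hint {y : K} (hy : IsIntegral ℤ y) (w : FinitePlace K) : w y ≤ 1 := by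
    rw [← FinitePlace.norm_embedding_eq]
    exact FinitePlace.norm_le_one K w.maximalIdeal ⟨y, hy⟩
  have hprod := FinitePlace.prod_eq_inv_abs_norm hN0
  have hmax : (fun w : FinitePlace K => max (w x) 1).HasFiniteMulSupport := by
    rcases eq_or_ne x 0 with rfl | hx0
    · simp [Function.HasFiniteMulSupport]
    · refine (FinitePlace.hasFiniteMulSupport hx0).subset fun w hw hw1 => hw ?_
      simp only at hw1
      simp [hw1]
  have hle : (∏ᶠ w : FinitePlace K, max (w x) 1) * ∏ᶠ w : FinitePlace K, w (N : K) ≤ 1 := by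
    rw [← finprod_mul_distrib hmax (FinitePlace.hasFiniteMulSupport hN0)]
    refine (finprod_induction (p := fun y : ℝ => 0 ≤ y ∧ y ≤ 1) (by simp)
      (fun a b ha hb => ⟨mul_nonneg ha.1 hb.1, mul_le_one₀ ha.2 hb.1 hb.2⟩) fun w => ?_).2
    have hw0 : 0 ≤ w (N : K) := apply_nonneg w _
    refine ⟨mul_nonneg (zero_le_one.trans (le_max_right _ _)) hw0, ?_⟩
    rw [max_mul_of_nonneg _ _ hw0, one_mul, mul_comm, ← map_mul]
    exact max_le (hint hx w) (hint (isIntegral_natCast ..) w)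
  have hnorm : (|Algebra.norm ℚ (N : K)| : ℚ) = (N : ℚ) ^ Module.finrank ℚ K := by
    have := Algebra.norm_algebraMap (S := K) (N : ℚ)
    rw [map_natCast] at this
    rw [this, abs_of_nonneg (by positivity)]
  rw [hprod, hnorm] at hle
  push_cast at hle
  rwa [mul_inv_le_iff₀ (by positivity), one_mul] at hle

theorem NumberField.logHeight₁_le {x : K} {N : ℕ} (hN : N ≠ 0)
    (hx : IsIntegral ℤ ((N : K) * x)) :
    logHeight₁ x ≤ ∑ φ : K →+* ℂ, log⁺ ‖φ x‖ + Module.finrank ℚ K * log N := by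
  classical
  have h1 : ∏ v : InfinitePlace K, max (v x) 1 ^ v.mult = ∏ φ : K →+* ℂ, max ‖φ x‖ 1 := by
    rw [← Finset.prod_fiberwise Finset.univ InfinitePlace.mk]
    refine Finset.prod_congr rfl fun v _ => ?_
    rw [← InfinitePlace.card_filter_mk_eq, ← Finset.prod_const]
    refine Finset.prod_congr rfl fun φ hφ => ?_
    rw [← (Finset.mem_filter.mp hφ).2, InfinitePlace.apply]
  have h2 := finprod_max_one_le_pow hN hx
  have hpos : 0 < ∏ φ : K →+* ℂ, max ‖φ x‖ 1 :=
    Finset.prod_pos fun _ _ => lt_max_of_lt_right one_pos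
  have h3 : mulHeight₁ x ≤ (∏ φ : K →+* ℂ, max ‖φ x‖ 1) * (N : ℝ) ^ Module.finrank ℚ K := by
    rw [NumberField.mulHeight₁_eq, h1]
    exact mul_le_mul_of_nonneg_left h2 hpos.le
  have hNpos : (0 : ℝ) < N := by positivity
  refine (log_le_log (mulHeight₁_pos x) h3).trans_eq ?_
  rw [log_mul hpos.ne' (by positivity), log_pow, log_prod fun φ _ => (lt_max_of_lt_right one_pos).ne']
  congr 1
  refine Finset.sum_congr rfl fun φ _ => ?_
  rw [posLog_eq_log_max_one (norm_nonneg _), max_comm]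

open IntermediateField in
theorem absLogHeight₁_le {F : Type*} [Field F] [CharZero F] {t : F} (ht : IsIntegral ℚ t) {N : ℕ}
    (hN : N ≠ 0) (hNt : IsIntegral ℤ ((N : F) * t)) {S : Finset ℂ}
    (hS : ∀ z : ℂ, Polynomial.aeval z (minpoly ℚ t) = 0 → z ∈ S) {B : ℝ}
    (hB : ∑ z ∈ S, log⁺ ‖z‖ ≤ B * (minpoly ℚ t).natDegree) :
    absLogHeight₁ t ≤ log N + B := by
  classical
  have : FiniteDimensional ℚ ℚ⟮t⟯ := adjoin.finiteDimensional ht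
  have : NumberField ℚ⟮t⟯ := {}
  set x := AdjoinSimple.gen ℚ t with hx
  have hn : (0 : ℝ) < Module.finrank ℚ ℚ⟮t⟯ := Nat.cast_pos.mpr Module.finrank_pos
  have hdeg : Module.finrank ℚ ℚ⟮t⟯ = (minpoly ℚ t).natDegree := adjoin.finrank ht
  have hxint : IsIntegral ℤ ((N : ℚ⟮t⟯) * x) := by
    rw [← isIntegral_algebraMap_iff (algebraMap ℚ⟮t⟯ F).injective, map_mul, map_natCast]
    simpa [hx] using hNt
  have h1 : absLogHeight₁ t = (Module.finrank ℚ ℚ⟮t⟯ : ℝ)⁻¹ * logHeight₁ x := by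
    rw [absLogHeight₁, absMulHeight₁, dif_pos ht, log_rpow (mulHeight₁_pos _),
      logHeight₁_eq_log_mulHeight₁]
  have hinj : Function.Injective fun φ : ℚ⟮t⟯ →+* ℂ => φ x := by
    intro φ ψ h
    have h2 : φ.toRatAlgHom = ψ.toRatAlgHom := algHom_ext_of_eq_adjoin _ rfl fun y hy => by
      obtain rfl : y = t := hy
      exact h
    ext y
    exact DFunLike.congr_fun h2 y
  have h2 : ∑ φ : ℚ⟮t⟯ →+* ℂ, log⁺ ‖φ x‖ ≤ B * (minpoly ℚ t).natDegree := by
    refine le_trans ?_ hB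
    rw [← Finset.sum_image (s := Finset.univ) (g := fun φ : ℚ⟮t⟯ →+* ℂ => φ x)
      (f := fun z => log⁺ ‖z‖) hinj.injOn]
    refine Finset.sum_le_sum_of_subset_of_nonneg ?_ fun _ _ _ => posLog_nonneg
    intro z hz
    obtain ⟨φ, -, rfl⟩ := Finset.mem_image.mp hz
    refine hS _ ?_
    have h0 : (minpoly ℚ t).eval₂ (Rat.castHom ℚ⟮t⟯) x = 0 := by
      refine (algebraMap ℚ⟮t⟯ F).injective ?_
      rw [Polynomial.hom_eval₂, map_zero,
        Subsingleton.elim ((algebraMap ℚ⟮t⟯ F).comp (Rat.castHom ℚ⟮t⟯)) (algebraMap ℚ F)]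
      exact minpoly.aeval ℚ t
    rw [Polynomial.aeval_def, Subsingleton.elim (algebraMap ℚ ℂ) (φ.comp (Rat.castHom ℚ⟮t⟯)),
      ← Polynomial.hom_eval₂, h0, map_zero]
  have h3 := logHeight₁_le hN hxint
  rw [h1, inv_mul_le_iff₀ hn]
  rw [← hdeg] at h2
  linarith

end Height

/-! ### Escape at an infinite place. -/

section Archimedean

theorem half_norm_le_norm_unicriticalMap {d : ℕ} {t z : ℂ} {R : ℝ} (hz : ‖z‖ ≤ R)
    (ht : 2 * R ^ d ≤ ‖t‖) :
    ‖t‖ / 2 ≤ ‖unicriticalMap d t z‖ ∧ ‖unicriticalMap d t z‖ ≤ 3 / 2 * ‖t‖ := by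
  have h1 : ‖z ^ d‖ ≤ R ^ d := by
    rw [norm_pow]; exact pow_le_pow_left₀ (norm_nonneg _) hz d
  have h2 := norm_add_le (z ^ d) t
  have h3 := norm_sub_le_norm_add t (z ^ d)
  rw [add_comm t] at h3
  unfold unicriticalMap
  constructor <;> linarith

/-- The threshold 24 makes `(|t| / 2) ^ 2 ≥ 6 |t|`. -/
theorem three_mul_norm_le_norm_unicriticalMap {d : ℕ} (hd : 2 ≤ d) {t z : ℂ} (ht : 24 < ‖t‖)
    (hz : ‖t‖ / 2 ≤ ‖z‖) :
    6 * ‖t‖ ≤ ‖z‖ ^ d ∧ 3 * ‖t‖ ≤ ‖unicriticalMap d t z‖ ∧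
      ‖z‖ ^ d - ‖t‖ ≤ ‖unicriticalMap d t z‖ := by
  have h1 : ‖z‖ ^ 2 ≤ ‖z‖ ^ d := pow_le_pow_right₀ (by linarith) hd
  have h2 : 6 * ‖t‖ ≤ ‖z‖ ^ 2 := by nlinarith
  have h3 := norm_sub_le_norm_add (z ^ d) t
  rw [norm_pow] at h3
  unfold unicriticalMap
  refine ⟨by linarith, by linarith, h3⟩

/-- The ratio 2 persists: `|x| ^ d ≥ 4 |y| ^ d` and `|x| ^ d ≥ 6 |t|` give `2 (|y| ^ d + |t|) ≤ |x|
^ d - |t|`. -/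
theorem iterate_unicriticalMap_ne {d : ℕ} (hd : 2 ≤ d) {t x y : ℂ} (ht : 24 < ‖t‖)
    (hx : ‖t‖ / 2 ≤ ‖x‖) (hxy : 2 * ‖y‖ ≤ ‖x‖) (j : ℕ) :
    (unicriticalMap d t)^[j] y ≠ (unicriticalMap d t)^[j] x := by
  induction j generalizing x y with
  | zero =>
    rintro (rfl : y = x)
    linarith
  | succ j ih =>
    rw [Function.iterate_succ_apply, Function.iterate_succ_apply]
    obtain ⟨h1, h2, h3⟩ := three_mul_norm_le_norm_unicriticalMap hd ht hx
    refine ih (by linarith) ?_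
    have h4 : ‖unicriticalMap d t y‖ ≤ ‖y‖ ^ d + ‖t‖ := by
      rw [← norm_pow]; exact norm_add_le _ _
    have h5 : (2 * ‖y‖) ^ d ≤ ‖x‖ ^ d := pow_le_pow_left₀ (by positivity) hxy d
    have h6 : (2 : ℝ) ^ 2 ≤ 2 ^ d := pow_le_pow_right₀ one_le_two hd
    have h7 : 0 ≤ ‖y‖ ^ d := by positivity
    rw [mul_pow] at h5
    nlinarith

theorem norm_le_of_iterate_eq_of_lt {d : ℕ} (hd : 2 ≤ d) {t a b : ℂ} {R : ℝ} (ha : ‖a‖ ≤ R)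
    (hb : ‖b‖ ≤ R) {m n : ℕ} (hm : 0 < m) (hmn : m < n)
    (h : (unicriticalMap d t)^[m] a = (unicriticalMap d t)^[n] b) :
    ‖t‖ ≤ 24 + 2 * R ^ d := by
  by_contra! hlt
  have hR : 0 ≤ R ^ d := pow_nonneg ((norm_nonneg a).trans ha) d
  have ht : 24 < ‖t‖ := by linarith
  obtain ⟨m, rfl⟩ := Nat.exists_eq_succ_of_ne_zero hm.ne'
  obtain ⟨i, rfl⟩ := Nat.exists_eq_add_of_lt hmn
  rw [show m.succ + i + 1 = m + ((i + 1) + 1) by omega, Function.iterate_add_apply,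
    Function.iterate_succ_apply, Function.iterate_succ_apply _ (i + 1)] at h
  have hfa := (half_norm_le_norm_unicriticalMap (d := d) (t := t) ha (by linarith)).2
  have hfb := (half_norm_le_norm_unicriticalMap (d := d) (t := t) hb (by linarith)).1
  have hit (s : ℕ) : ‖t‖ / 2 ≤ ‖(unicriticalMap d t)^[s] (unicriticalMap d t b)‖ := by
    induction s with
    | zero => exact hfb
    | succ s ih =>
      rw [Function.iterate_succ_apply']
      linarith [(three_mul_norm_le_norm_unicriticalMap hd ht ih).2.1]
  refine iterate_unicriticalMap_ne hd ht (hit (i + 1)) ?_ m h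
  rw [Function.iterate_succ_apply']
  linarith [(three_mul_norm_le_norm_unicriticalMap hd ht (hit i)).2.1]

theorem norm_iterate_unicriticalMap_le {d : ℕ} (hd : 2 ≤ d) {t a : ℂ} (ht : ‖t‖ ≤ 1) {R : ℝ}
    (ha : ‖a‖ + 2 ≤ R) (i : ℕ) : ‖(unicriticalMap d t)^[i] a‖ ≤ R ^ d ^ i := by
  -- The extra 1 absorbs the added `t` at each step of the induction.
  suffices h : ∀ i, ‖(unicriticalMap d t)^[i] a‖ + 1 ≤ R ^ d ^ i ∧ 2 ≤ R ^ d ^ i from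
    by linarith [(h i).1]
  intro i
  have hR : 2 ≤ R := by linarith [norm_nonneg a]
  induction i with
  | zero => simp only [pow_zero, pow_one, Function.iterate_zero, id]; exact ⟨by linarith, hR⟩
  | succ i ih =>
    obtain ⟨h1, h2⟩ := ih
    rw [Function.iterate_succ_apply', pow_succ, pow_mul]
    set S := R ^ d ^ i
    set x := (unicriticalMap d t)^[i] a
    have h3 : ‖unicriticalMap d t x‖ ≤ ‖x‖ ^ d + ‖t‖ := by
      rw [← norm_pow]; exact norm_add_le _ _
    have h4 : ‖x‖ ^ d ≤ (S - 1) ^ d := pow_le_pow_left₀ (norm_nonneg _) (by linarith) d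
    obtain ⟨e, rfl⟩ : ∃ e, d = e + 1 := ⟨d - 1, by omega⟩
    have h5 : (S - 1) ^ e ≤ S ^ e := pow_le_pow_left₀ (by linarith) (by linarith) e
    have h6 : S ≤ S ^ e := le_self_pow₀ (by linarith) (by omega)
    rw [pow_succ (S - 1) e] at h4
    rw [pow_succ S e]
    constructor <;> nlinarith

end Archimedean

/-! ### Mahler measure of the collision polynomials. -/

section Polynomial

open Polynomial Real

/-- The `i`-th iterate of `z ↦ z ^ d + X` at the constant `a`, a polynomial in the parameter `X`. -/
noncomputable def orbitPoly (d : ℕ) (a : ℂ) (i : ℕ) : ℂ[X] := (unicriticalMap d X)^[i] (C a)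

theorem eval_orbitPoly (d : ℕ) (a : ℂ) (i : ℕ) (z : ℂ) :
    (orbitPoly d a i).eval z = (unicriticalMap d z)^[i] a := by
  simpa [orbitPoly] using map_iterate_unicriticalMap (evalRingHom z) d X i (C a)

theorem monic_and_natDegree_orbitPoly {d : ℕ} (hd : 2 ≤ d) (a : ℂ) (i : ℕ) :
    (orbitPoly d a (i + 1)).Monic ∧ (orbitPoly d a (i + 1)).natDegree = d ^ i := by
  induction i with
  | zero =>
    have : orbitPoly d a 1 = X + C (a ^ d) := by
      simp [orbitPoly, unicriticalMap, add_comm]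
    rw [zero_add, this]
    exact ⟨monic_X_add_C _, natDegree_X_add_C _⟩
  | succ i ih =>
    obtain ⟨h1, h2⟩ := ih
    have hs : orbitPoly d a (i + 1 + 1) = orbitPoly d a (i + 1) ^ d + X := by
      rw [orbitPoly, Function.iterate_succ_apply']; rfl
    have hdeg : (orbitPoly d a (i + 1) ^ d).natDegree = d ^ (i + 1) := by
      rw [h1.natDegree_pow, h2, pow_succ']
    have hlt : 1 < d ^ (i + 1) := one_lt_pow₀ (by omega) (by omega)
    have hX : (X : ℂ[X]).natDegree < (orbitPoly d a (i + 1) ^ d).natDegree := by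
      rw [hdeg, natDegree_X]; exact hlt
    rw [hs]
    refine ⟨(h1.pow d).add_of_left (degree_lt_degree hX), ?_⟩
    rw [natDegree_add_eq_left_of_natDegree_lt hX, hdeg]

/-- The cofactor of `f ^ i (a) - f ^ i (b)` in `f ^ (i + 1) (a) - f ^ (i + 1) (b)`, as a polynomial
in the parameter. -/
noncomputable def collisionPoly (d : ℕ) (a b : ℂ) (i : ℕ) : ℂ[X] :=
  ∑ r ∈ Finset.range d, orbitPoly d a i ^ r * orbitPoly d b i ^ (d - 1 - r)

/-- The `d` summands are monic of the same degree, so nothing cancels. -/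
theorem leadingCoeff_collisionPoly {d : ℕ} (hd : 2 ≤ d) (a b : ℂ) (i : ℕ) :
    (collisionPoly d a b (i + 1)).leadingCoeff = d := by
  obtain ⟨ha1, ha2⟩ := monic_and_natDegree_orbitPoly hd a i
  obtain ⟨hb1, hb2⟩ := monic_and_natDegree_orbitPoly hd b i
  have hterm : ∀ r ∈ Finset.range d,
      (orbitPoly d a (i + 1) ^ r * orbitPoly d b (i + 1) ^ (d - 1 - r)).natDegree =
        (d - 1) * d ^ i := by
    intro r hr
    have hr' := Finset.mem_range.mp hr
    rw [(ha1.pow r).natDegree_mul (hb1.pow _), ha1.natDegree_pow, hb1.natDegree_pow, ha2, hb2,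
      ← add_mul]
    congr 1
    omega
  have hle : (collisionPoly d a b (i + 1)).natDegree ≤ (d - 1) * d ^ i :=
    natDegree_sum_le_of_forall_le _ _ fun r hr => (hterm r hr).le
  have hcoeff : (collisionPoly d a b (i + 1)).coeff ((d - 1) * d ^ i) = d := by
    rw [collisionPoly, finsetSum_coeff, Finset.sum_congr rfl (g := fun _ => (1 : ℂ))]
    · simp
    · intro r hr
      rw [← hterm r hr]
      exact (ha1.pow r).mul (hb1.pow _)
  have hd0 : (d : ℂ) ≠ 0 := Nat.cast_ne_zero.mpr (by omega)
  have hdeg := le_antisymm hle (le_natDegree_of_ne_zero (by rw [hcoeff]; exact hd0))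
  rw [leadingCoeff, hdeg, hcoeff]

theorem norm_eval_collisionPoly_le {d : ℕ} (hd : 2 ≤ d) {a b z : ℂ} (hz : ‖z‖ ≤ 1) {R : ℝ}
    (ha : ‖a‖ + 2 ≤ R) (hb : ‖b‖ + 2 ≤ R) (i : ℕ) :
    ‖(collisionPoly d a b i).eval z‖ ≤ d * R ^ d ^ (i + 1) := by
  have hR : 1 ≤ R := by linarith [norm_nonneg a]
  rw [collisionPoly, eval_finsetSum]
  refine (norm_sum_le_of_le (Finset.range d) (f := _) (n := fun _ => R ^ d ^ (i + 1)) ?_).trans_eq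
    (by simp)
  intro r hr
  have hr' := Finset.mem_range.mp hr
  rw [eval_mul, eval_pow, eval_pow, eval_orbitPoly, eval_orbitPoly, norm_mul, norm_pow, norm_pow]
  have h1 := norm_iterate_unicriticalMap_le hd hz ha i
  have h2 := norm_iterate_unicriticalMap_le hd hz hb i
  calc _ ≤ (R ^ d ^ i) ^ r * (R ^ d ^ i) ^ (d - 1 - r) := by gcongr
    _ = (R ^ d ^ i) ^ (d - 1) := by rw [← pow_add]; congr 1; omega
    _ ≤ (R ^ d ^ i) ^ d := pow_le_pow_right₀ (one_le_pow₀ hR) (by omega)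
    _ = R ^ d ^ (i + 1) := by rw [pow_succ d i, pow_mul]

/-- By Jensen's formula the sum is the logarithmic Mahler measure minus `log d ≥ 0`, and the measure
is at most the logarithm of a bound on the unit circle. -/
theorem sum_posLog_roots_collisionPoly_le {d : ℕ} (hd : 2 ≤ d) {a b : ℂ} {R : ℝ}
    (ha : ‖a‖ + 2 ≤ R) (hb : ‖b‖ + 2 ≤ R) (i : ℕ) :
    ((collisionPoly d a b (i + 1)).roots.map fun z => log⁺ ‖z‖).sum ≤
      d ^ i * (d + d ^ 2 * log R) := by
  set P := collisionPoly d a b (i + 1)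
  have hR : 1 ≤ R := by linarith [norm_nonneg a]
  have hd1 : (1 : ℝ) ≤ d := by exact_mod_cast (by omega : 1 ≤ d)
  have h1 := logMahlerMeasure_eq_log_leadingCoeff_add_sum_log_roots P
  rw [leadingCoeff_collisionPoly hd, Complex.norm_natCast] at h1
  have hlog := log_nonneg hd1
  have hRpow : (1 : ℝ) ≤ R ^ d ^ (i + 1 + 1) := one_le_pow₀ hR
  have h2 : P.logMahlerMeasure ≤ log (d * R ^ d ^ (i + 1 + 1)) := by
    rw [logMahlerMeasure_def]
    refine circleAverage_mono_on_of_le_circle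
      (MeromorphicOn.circleIntegrable_log_norm fun z _ => ?_) fun z hz => ?_
    · exact ((AnalyticOnNhd.eval_polynomial P) z (Set.mem_univ _)).meromorphicAt
    · have hz1 : ‖z‖ ≤ 1 := by simpa using hz.le
      rcases (norm_nonneg (eval z P)).eq_or_lt with h0 | h0
      · rw [← h0, log_zero]
        exact log_nonneg (one_le_mul_of_one_le_of_one_le hd1 hRpow)
      · exact log_le_log h0 (norm_eval_collisionPoly_le hd hz1 ha hb (i + 1))
  rw [log_mul (by positivity) (by positivity), log_pow] at h2
  have h3 : log d ≤ d := (log_le_sub_one_of_pos (by positivity)).trans (by linarith)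
  have h4 : (1 : ℝ) ≤ (d : ℝ) ^ i := one_le_pow₀ hd1
  have h5 : (d : ℝ) ≤ d ^ i * d := le_mul_of_one_le_left (by positivity) h4
  push_cast at h2
  have h6 : (d : ℝ) ^ (i + 1 + 1) * log R = d ^ i * (d ^ 2 * log R) := by ring
  rw [h6] at h2
  linarith

end Polynomial

theorem sum_biUnion_le_of_nonneg {ι α : Type*} [DecidableEq α] {f : α → ℝ} (hf : ∀ x, 0 ≤ f x)
    (s : Finset ι) (g : ι → Finset α) :
    ∑ x ∈ s.biUnion g, f x ≤ ∑ i ∈ s, ∑ x ∈ g i, f x := by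
  classical
  induction s using Finset.induction_on with
  | empty => simp
  | insert i s hi ih =>
    rw [Finset.biUnion_insert, Finset.sum_insert hi]
    have h1 := Finset.sum_union_inter (s₁ := g i) (s₂ := s.biUnion g) (f := f)
    have h2 : 0 ≤ ∑ x ∈ g i ∩ s.biUnion g, f x := Finset.sum_nonneg fun x _ => hf x
    linarith

/-! ### Global height bounds. -/

section Collision

open NumberField IntermediateField Polynomial Real

instance Qbar.isAlgebraic : Algebra.IsAlgebraic ℚ Qbar := by
  convert! AlgebraicClosure.isAlgebraic ℚ

theorem Qbar.isIntegral_rat (x : Qbar) : IsIntegral ℚ x := Algebra.IsIntegral.isIntegral x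

theorem Qbar.exists_natCast_mul_isIntegral (a : Qbar) :
    ∃ N : ℕ, N ≠ 0 ∧ IsIntegral ℤ ((N : Qbar) * a) := by
  have ha : IsAlgebraic ℤ a := (IsFractionRing.isAlgebraic_iff ℤ ℚ Qbar).mpr
    (Qbar.isIntegral_rat a).isAlgebraic
  obtain ⟨y, hy, hint⟩ := ha.exists_integral_multiple
  refine ⟨y.natAbs, by simpa using hy, ?_⟩
  rw [← Int.cast_natCast]
  rw [zsmul_eq_mul] at hint
  rcases Int.natAbs_eq y with h | h
  · rwa [← h]
  · rw [show ((y.natAbs : ℤ)) = -y by omega, Int.cast_neg, neg_mul]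
    exact hint.neg

theorem Qbar.exists_ringHom_eq_of_aeval_minpoly {t : Qbar} {z : ℂ}
    (hz : aeval z (minpoly ℚ t) = 0) : ∃ σ : Qbar →+* ℂ, σ t = z := by
  have h := Algebra.IsAlgebraic.range_eval_eq_rootSet_minpoly (F := ℚ) (K := Qbar) ℂ t
  have hz' : z ∈ (minpoly ℚ t).rootSet ℂ :=
    mem_rootSet.mpr ⟨minpoly.ne_zero (Qbar.isIntegral_rat t), hz⟩
  rw [← h] at hz'
  obtain ⟨φ, hφ⟩ := hz'
  exact ⟨φ, hφ⟩

/-- The finite set of complex conjugates of an algebraic number. -/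
noncomputable def Qbar.conjugates (a : Qbar) : Finset ℂ :=
  ((minpoly ℚ a).aroots ℂ).toFinset

theorem Qbar.map_mem_conjugates (a : Qbar) (σ : Qbar →+* ℂ) : σ a ∈ conjugates a := by
  rw [conjugates, Multiset.mem_toFinset, mem_aroots]
  refine ⟨minpoly.ne_zero (Qbar.isIntegral_rat a), ?_⟩
  have := congrArg σ (minpoly.aeval ℚ a)
  rwa [map_zero, aeval_def, hom_eval₂,
    Subsingleton.elim (σ.comp (algebraMap ℚ Qbar)) (algebraMap ℚ ℂ)] at this

theorem Qbar.card_conjugates_le (a : Qbar) : (conjugates a).card ≤ (minpoly ℚ a).natDegree :=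
  (Multiset.toFinset_card_le _).trans ((card_roots' _).trans natDegree_map_le)

theorem Qbar.exists_norm_map_le (a b : Qbar) :
    ∃ R : ℝ, ∀ σ : Qbar →+* ℂ, ‖σ a‖ ≤ R ∧ ‖σ b‖ ≤ R := by
  refine ⟨∑ z ∈ conjugates a, ‖z‖ + ∑ z ∈ conjugates b, ‖z‖, fun σ => ?_⟩
  have h1 := Finset.single_le_sum (f := fun z : ℂ => ‖z‖) (fun _ _ => norm_nonneg _)
    (map_mem_conjugates a σ)
  have h2 := Finset.single_le_sum (f := fun z : ℂ => ‖z‖) (fun _ _ => norm_nonneg _)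
    (map_mem_conjugates b σ)
  have h3 := Finset.sum_nonneg (s := conjugates a) (f := fun z : ℂ => ‖z‖) fun _ _ => norm_nonneg _
  have h4 := Finset.sum_nonneg (s := conjugates b) (f := fun z : ℂ => ‖z‖) fun _ _ => norm_nonneg _
  constructor <;> linarith

theorem Qbar.exists_numberField_lift (a b t : Qbar) :
    ∃ (L : IntermediateField ℚ Qbar) (_ : NumberField L) (a' b' t' : L),
      (a' : Qbar) = a ∧ (b' : Qbar) = b ∧ (t' : Qbar) = t ∧
      Module.finrank ℚ L ≤ (minpoly ℚ a).natDegree * (minpoly ℚ b).natDegree *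
        (minpoly ℚ t).natDegree := by
  have h (x : Qbar) : FiniteDimensional ℚ ℚ⟮x⟯ := adjoin.finiteDimensional (isIntegral_rat x)
  have := h a
  have := h b
  have := h t
  have : FiniteDimensional ℚ (ℚ⟮a⟯ ⊔ ℚ⟮b⟯ ⊔ ℚ⟮t⟯ : IntermediateField ℚ Qbar) := inferInstance
  refine ⟨ℚ⟮a⟯ ⊔ ℚ⟮b⟯ ⊔ ℚ⟮t⟯, {}, ⟨a, ?_⟩, ⟨b, ?_⟩, ⟨t, ?_⟩, rfl, rfl, rfl, ?_⟩
  · exact (le_sup_left.trans le_sup_left : ℚ⟮a⟯ ≤ _) (mem_adjoin_simple_self ℚ a)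
  · exact (le_sup_right.trans le_sup_left : ℚ⟮b⟯ ≤ _) (mem_adjoin_simple_self ℚ b)
  · exact (le_sup_right : ℚ⟮t⟯ ≤ _) (mem_adjoin_simple_self ℚ t)
  · rw [← adjoin.finrank (isIntegral_rat a), ← adjoin.finrank (isIntegral_rat b),
      ← adjoin.finrank (isIntegral_rat t)]
    exact (finrank_sup_le _ _).trans (Nat.mul_le_mul_right _ (finrank_sup_le _ _))

theorem IntermediateField.coe_iterate_unicriticalMap (L : IntermediateField ℚ Qbar) (d : ℕ)
    (t z : L) (m : ℕ) :
    (((unicriticalMap d t)^[m] z : L) : Qbar) = (unicriticalMap d (t : Qbar))^[m] (z : Qbar) :=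
  map_iterate_unicriticalMap (algebraMap L Qbar) d t m z

/-- Height bound for the parameters at which the orbits collide at different times. -/
theorem absLogHeight₁_le_of_iterate_eq_of_lt {d : ℕ} (hd : 2 ≤ d) {a b t : Qbar} {N : ℕ}
    (hN : N ≠ 0) (hNa : IsIntegral ℤ ((N : Qbar) * a)) (hNb : IsIntegral ℤ ((N : Qbar) * b))
    {R : ℝ} (hR : ∀ σ : Qbar →+* ℂ, ‖σ a‖ ≤ R ∧ ‖σ b‖ ≤ R) {m n : ℕ} (hm : 0 < m) (hmn : m < n)
    (h : (unicriticalMap d t)^[m] a = (unicriticalMap d t)^[n] b) :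
    absLogHeight₁ t ≤ log (N ^ d : ℕ) + log (24 + 2 * R ^ d) := by
  obtain ⟨L, _, a', b', t', rfl, rfl, rfl, -⟩ := Qbar.exists_numberField_lift a b t
  have hL : (unicriticalMap d t')^[m] a' = (unicriticalMap d t')^[n] b' := by
    apply Subtype.val_injective
    rw [coe_iterate_unicriticalMap, coe_iterate_unicriticalMap, h]
  have hlift {x : L} (hx : IsIntegral ℤ ((N : Qbar) * (x : Qbar))) :
      IsIntegral ℤ ((N : L) * x) := by
    rw [← isIntegral_algebraMap_iff (algebraMap L Qbar).injective, map_mul, map_natCast]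
    exact hx
  have hint : IsIntegral ℤ (((N ^ d * 1 : ℕ) : L) * t') := by
    refine isIntegral_natCast_mul_of_valuation_le (hlift hNa) (hlift hNb) fun w => ?_
    rw [Nat.cast_one, one_mul]
    exact (w.valuation L).map_le_of_iterate_eq_of_lt (by omega) hm hmn hL
  have hint' : IsIntegral ℤ (((N ^ d : ℕ) : Qbar) * (t' : Qbar)) := by
    rw [mul_one, ← isIntegral_algebraMap_iff (algebraMap L Qbar).injective, map_mul,
      map_natCast] at hint
    exact hint
  refine absLogHeight₁_le (S := Qbar.conjugates t') (Qbar.isIntegral_rat _) (pow_ne_zero d hN)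
    hint' (fun z hz => ?_) ?_
  · rw [Qbar.conjugates, Multiset.mem_toFinset, mem_aroots]
    exact ⟨minpoly.ne_zero (Qbar.isIntegral_rat _), hz⟩
  · have hz : ∀ z ∈ Qbar.conjugates t', log⁺ ‖z‖ ≤ log (24 + 2 * R ^ d) := by
      intro z hz
      obtain ⟨σ, rfl⟩ := Qbar.exists_ringHom_eq_of_aeval_minpoly
        (mem_aroots.mp (Multiset.mem_toFinset.mp hz)).2
      obtain ⟨ha, hb⟩ := hR σ
      have hσ : (unicriticalMap d (σ t'))^[m] (σ a') = (unicriticalMap d (σ t'))^[n] (σ b') := by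
        rw [← map_iterate_unicriticalMap, ← map_iterate_unicriticalMap, h]
      have hpos : 0 ≤ R ^ d := pow_nonneg ((norm_nonneg _).trans ha) d
      rw [posLog_eq_log_max_one (norm_nonneg _)]
      exact log_le_log (lt_max_of_lt_left one_pos)
        (max_le (by linarith) (norm_le_of_iterate_eq_of_lt hd ha hb hm hmn hσ))
    have hlog : 0 ≤ log (24 + 2 * R ^ d) := by
      obtain ⟨σ, -⟩ : ∃ σ : Qbar →+* ℂ, True :=
        ⟨(IsAlgClosed.lift : Qbar →ₐ[ℚ] ℂ).toRingHom, trivial⟩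
      have hpos : 0 ≤ R ^ d := pow_nonneg ((norm_nonneg _).trans (hR σ).1) d
      exact log_nonneg (by linarith)
    calc _ ≤ (Qbar.conjugates t').card • log (24 + 2 * R ^ d) := Finset.sum_le_card_nsmul _ _ _ hz
      _ ≤ _ := by
        rw [nsmul_eq_mul, mul_comm]
        exact mul_le_mul_of_nonneg_left (Nat.cast_le.mpr (Qbar.card_conjugates_le _)) hlog

/-- Height bound for the parameters at which the orbits of a point that is not integral and of
an integral point first collide at the same time. -/
theorem absLogHeight₁_le_of_iterate_eq {p k : ℕ} (hp : p.Prime) (hk : k ≠ 0) {a b t : Qbar} {N : ℕ}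
    (hN : N ≠ 0) (hNa : IsIntegral ℤ ((N : Qbar) * a)) (ha : ¬ IsIntegral ℤ a)
    (hb : IsIntegral ℤ b) {R : ℝ} (hR : ∀ σ : Qbar →+* ℂ, ‖σ a‖ ≤ R ∧ ‖σ b‖ ≤ R) {j : ℕ}
    (hne : (unicriticalMap (p ^ k) t)^[j + 1] a ≠ (unicriticalMap (p ^ k) t)^[j + 1] b)
    (heq : (unicriticalMap (p ^ k) t)^[j + 2] a = (unicriticalMap (p ^ k) t)^[j + 2] b) :
    absLogHeight₁ t ≤ log (N ^ p ^ k * p : ℕ) +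
      ((Qbar.conjugates a).card * (Qbar.conjugates b).card) *
        ((p ^ k : ℕ) + (p ^ k : ℕ) ^ 2 * log (R + 2)) *
        (p * N ^ (2 * p) * ((minpoly ℚ a).natDegree * (minpoly ℚ b).natDegree) : ℕ) := by
  set d := p ^ k with hd
  have hd2 : 2 ≤ d := (one_lt_pow₀ hp.one_lt hk : 1 < p ^ k)
  obtain ⟨L, _, a', b', t', rfl, rfl, rfl, hdeg⟩ := Qbar.exists_numberField_lift a b t
  have heqL : (unicriticalMap d t')^[j + 2] a' = (unicriticalMap d t')^[j + 2] b' := by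
    apply Subtype.val_injective
    rw [coe_iterate_unicriticalMap, coe_iterate_unicriticalMap, heq]
  have hneL : (unicriticalMap d t')^[j + 1] a' ≠ (unicriticalMap d t')^[j + 1] b' := by
    intro h
    apply hne
    rw [← coe_iterate_unicriticalMap, ← coe_iterate_unicriticalMap, h]
  have hiff {x : L} : IsIntegral ℤ (x : Qbar) ↔ IsIntegral ℤ x :=
    isIntegral_algebraMap_iff (algebraMap L Qbar).injective
  have hNa' : IsIntegral ℤ ((N : L) * a') := by
    rw [← hiff]; exact_mod_cast hNa
  have hint : IsIntegral ℤ (((N ^ d * p : ℕ) : L) * t') :=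
    isIntegral_natCast_mul_of_valuation_le hNa' ((isIntegral_natCast ..).mul (hiff.mp hb)) fun w =>
      (w.valuation L).map_prime_mul_le_of_iterate_eq hp hk hneL heqL
  have hint' : IsIntegral ℤ (((N ^ d * p : ℕ) : Qbar) * (t' : Qbar)) := by
    rw [← hiff] at hint; exact_mod_cast hint
  have hpow := NumberField.pow_le_finrank_of_iterate_eq hp hk hN hNa' (mt hiff.mpr ha)
    (hiff.mp hb) hneL heqL
  rw [← hd] at hpow
  set A := Qbar.conjugates a'
  set B := Qbar.conjugates b'
  classical
  obtain ⟨σ₀, -⟩ : ∃ σ : Qbar →+* ℂ, True :=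
    ⟨(IsAlgClosed.lift : Qbar →ₐ[ℚ] ℂ).toRingHom, trivial⟩
  have hR0 : 0 ≤ R := (norm_nonneg _).trans (hR σ₀).1
  set G : ℝ := (d : ℝ) + (d : ℝ) ^ 2 * log (R + 2) with hG
  have hG0 : 0 ≤ G := by
    have := log_nonneg (by linarith : 1 ≤ R + 2)
    positivity
  have hconj {x : Qbar} {z : ℂ} (hz : z ∈ Qbar.conjugates x) : ∃ σ : Qbar →+* ℂ, σ x = z :=
    Qbar.exists_ringHom_eq_of_aeval_minpoly (mem_aroots.mp (Multiset.mem_toFinset.mp hz)).2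
  -- A conjugation of `t` also moves `a` and `b`, so roots are collected over all pairs of
  -- conjugates.
  refine absLogHeight₁_le
    (S := (A ×ˢ B).biUnion fun c => (collisionPoly d c.1 c.2 (j + 1)).roots.toFinset)
    (Qbar.isIntegral_rat _) (mul_ne_zero (pow_ne_zero d hN) hp.ne_zero) hint' (fun z hz => ?_) ?_
  · obtain ⟨σ, rfl⟩ := Qbar.exists_ringHom_eq_of_aeval_minpoly hz
    refine Finset.mem_biUnion.mpr ⟨(σ a', σ b'), Finset.mk_mem_product
      (Qbar.map_mem_conjugates _ σ) (Qbar.map_mem_conjugates _ σ), ?_⟩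
    rw [Multiset.mem_toFinset, mem_roots', IsRoot.def]
    constructor
    · rw [← leadingCoeff_ne_zero, leadingCoeff_collisionPoly hd2]
      exact Nat.cast_ne_zero.mpr (by omega)
    · rw [collisionPoly, eval_finsetSum]
      simp only [eval_mul, eval_pow, eval_orbitPoly]
      rw [← map_iterate_unicriticalMap, ← map_iterate_unicriticalMap]
      simp only [← map_pow, ← map_mul, ← map_sum]
      rw [map_eq_zero_iff σ σ.injective]
      refine (mul_eq_zero_iff_right (sub_ne_zero.mpr hne)).mp ?_
      rw [geom_sum₂_mul, sub_eq_zero]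
      rw [Function.iterate_succ_apply', Function.iterate_succ_apply' _ (j + 1)] at heq
      exact add_right_cancel heq
  · have hsum : ∀ c ∈ A ×ˢ B,
        ∑ z ∈ (collisionPoly d c.1 c.2 (j + 1)).roots.toFinset, log⁺ ‖z‖ ≤ d ^ j * G := by
      intro c hc
      obtain ⟨h1, h2⟩ := Finset.mem_product.mp hc
      obtain ⟨σ, hσ⟩ := hconj h1
      obtain ⟨τ, hτ⟩ := hconj h2
      refine le_trans ?_ (sum_posLog_roots_collisionPoly_le hd2 (a := c.1) (b := c.2) (R := R + 2)
        (by rw [← hσ]; linarith [(hR σ).1]) (by rw [← hτ]; linarith [(hR τ).2]) j)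
      rw [Finset.sum_multiset_map_count]
      refine Finset.sum_le_sum fun z hz => ?_
      exact le_self_nsmul posLog_nonneg
        (Multiset.count_ne_zero.mpr (Multiset.mem_toFinset.mp hz))
    -- The lower bound on the degree of `t` absorbs the growth `d ^ j`, leaving a constant
    -- independent of `j`.
    have hdj : (d : ℝ) ^ j ≤ (p * N ^ (2 * p) * ((minpoly ℚ (a' : Qbar)).natDegree *
        (minpoly ℚ (b' : Qbar)).natDegree) : ℕ) * (minpoly ℚ (t' : Qbar)).natDegree := by
      have h := hpow.trans (Nat.mul_le_mul_left _ hdeg)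
      rw [← mul_assoc] at h
      exact_mod_cast h
    calc _ ≤ ∑ c ∈ A ×ˢ B, ∑ z ∈ (collisionPoly d c.1 c.2 (j + 1)).roots.toFinset, log⁺ ‖z‖ :=
          sum_biUnion_le_of_nonneg (fun _ => posLog_nonneg) _ _
      _ ≤ (A ×ˢ B).card • ((d : ℝ) ^ j * G) := Finset.sum_le_card_nsmul _ _ _ hsum
      _ = (A.card * B.card * G) * (d : ℝ) ^ j := by
          rw [Finset.card_product, nsmul_eq_mul]; push_cast; ring
      _ ≤ _ := by
          rw [mul_assoc (_ * _ * G)]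
          exact mul_le_mul_of_nonneg_left hdj (by positivity)

theorem hasBoundedHeight_collisions {d : ℕ} (hd : IsPrimePow d) {a b : Qbar}
    (ha : ¬ IsIntegral ℤ a) (hb : IsIntegral ℤ b) :
    HasBoundedHeight {t | ∃ m n : ℕ, 0 < m ∧ 0 < n ∧
      (unicritical d t)^[m] a = (unicritical d t)^[n] b} := by
  obtain ⟨p, k, hp, hk, rfl⟩ := (isPrimePow_nat_iff d).mp hd
  have hd2 : 2 ≤ p ^ k := (one_lt_pow₀ hp.one_lt hk.ne' : 1 < p ^ k)
  obtain ⟨N, hN, hNa⟩ := Qbar.exists_natCast_mul_isIntegral a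
  have hNb : IsIntegral ℤ ((N : Qbar) * b) := (isIntegral_natCast ..).mul hb
  obtain ⟨R, hR⟩ := Qbar.exists_norm_map_le a b
  obtain ⟨B₁, hB₁⟩ : ∃ B₁, ∀ (a' b' t : Qbar) (m n : ℕ), (a' = a ∧ b' = b ∨ a' = b ∧ b' = a) →
      0 < m → m < n → (unicriticalMap (p ^ k) t)^[m] a' = (unicriticalMap (p ^ k) t)^[n] b' →
      absLogHeight₁ t ≤ B₁ := by
    refine ⟨log (N ^ p ^ k : ℕ) + log (24 + 2 * R ^ p ^ k), ?_⟩
    rintro a' b' t m n (⟨rfl, rfl⟩ | ⟨rfl, rfl⟩) hm hmn h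
    · exact absLogHeight₁_le_of_iterate_eq_of_lt hd2 hN hNa hNb hR hm hmn h
    · exact absLogHeight₁_le_of_iterate_eq_of_lt hd2 hN hNb hNa (fun σ => (hR σ).symm) hm hmn h
  obtain ⟨B₂, hB₂⟩ : ∃ B₂, ∀ (t : Qbar) (j : ℕ),
      (unicriticalMap (p ^ k) t)^[j + 1] a ≠ (unicriticalMap (p ^ k) t)^[j + 1] b →
      (unicriticalMap (p ^ k) t)^[j + 2] a = (unicriticalMap (p ^ k) t)^[j + 2] b →
      absLogHeight₁ t ≤ B₂ :=
    ⟨_, fun t j hne heq => absLogHeight₁_le_of_iterate_eq hp hk.ne' hN hNa ha hb hR hne heq⟩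
  refine ⟨max B₁ B₂, fun t ⟨m, n, hm, hn, h⟩ => ?_⟩
  change (unicriticalMap (p ^ k) t)^[m] a = (unicriticalMap (p ^ k) t)^[n] b at h
  rcases lt_trichotomy m n with hmn | rfl | hmn
  · exact (hB₁ a b t m n (.inl ⟨rfl, rfl⟩) hm hmn h).trans (le_max_left _ _)
  · have hex : ∃ m, (unicriticalMap (p ^ k) t)^[m + 1] a = (unicriticalMap (p ^ k) t)^[m + 1] b :=
      ⟨m - 1, by rwa [Nat.sub_add_cancel hm]⟩
    classical
    have hspec := Nat.find_spec hex
    have hmin := fun i => Nat.find_min (m := i) hex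
    rcases hi : Nat.find hex with _ | j
    -- A collision at time 1 gives `a ^ d = b ^ d`, making `a` integral.
    · rw [hi] at hspec
      exfalso
      refine ha ?_
      have hpow : a ^ p ^ k = b ^ p ^ k := add_right_cancel hspec
      exact IsIntegral.of_pow (by omega) (hpow ▸ hb.pow (p ^ k))
    · rw [hi] at hspec
      exact (hB₂ t j (hmin j (by omega)) hspec).trans (le_max_right _ _)
  · exact (hB₁ b a t n m (.inr ⟨rfl, rfl⟩) hn hmn h.symm).trans (le_max_left _ _)

end Collision

theorem mainTheorem4 (d : ℕ) (hd : IsPrimePow d) (a b : Qbar)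
    (hab : Xor (IsIntegral ℤ a) (IsIntegral ℤ b)) :
    HasBoundedHeight
      {t₀ : Qbar | ∃ m n : ℕ, 0 < m ∧ 0 < n ∧
        (unicritical d t₀)^[m] a = (unicritical d t₀)^[n] b} := by
  rcases hab with ⟨ha, hb⟩ | ⟨hb, ha⟩
  · obtain ⟨B, hB⟩ := hasBoundedHeight_collisions hd hb ha
    exact ⟨B, fun t ⟨m, n, hm, hn, h⟩ => hB t ⟨n, m, hn, hm, h.symm⟩⟩
  · exact hasBoundedHeight_collisions hd ha hb
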